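/- **Theorem 2.3.** For an element $a$ of a complex Banach algebra with identity, a g-Drazin inverse of $a$ is an element $b$ with $ab=ba$, $b=bab$ and $\lim_{n\to\infty}\|(a-a^2b)^n\|^{1/n}=0$; it is unique if it exists and is denoted $a^d$, and $a^{\pi}=I-aa^d$. Let $E$ and $F$ be bounded linear operators on a complex Banach space $X$ that have g-Drazin inverses, and suppose $EF^2=0$ and $EFE=0$. Then the bounded operator $M=\begin{pmatrix}E&I\\F&0\end{pmatrix}$ on $X\times X$ has a g-Drazin inverse, all the series below converge in operator norm, and $$M^d=\begin{pmatrix}\Gamma&\Delta\\ \Lambda&\Xi\end{pmatrix},$$ where $$\begin{aligned} \Gamma={}&E^d+(E^d)^3F-F^dE^dF-(F^d)^2E^2E^dF-FF^dE^d+F^dEE^{\pi}+(F^d)^2EF-FF^d(E^d)^3F+(F^d)^3E^3E^{\pi}F\\ &+\sum_{i=1}^{\infty}F^{i}F^{\pi}(E^d)^{2i+1}+\sum_{i=1}^{\infty}(F^d)^{i+1}E^{2i+1}E^{\pi}+\sum_{i=1}^{\infty}F^{i}F^{\pi}(E^d)^{2i+3}F+\sum_{i=1}^{\infty}(F^d)^{i+3}E^{2i+3}E^{\pi}F,\\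 \Delta={}&(E^d)^2+(E^d)^4F-F^d(E^d)^2F-(F^d)^2EE^dF-FF^d(E^d)^2+F^dE^{\pi}-FF^d(E^d)^4F+(F^d)^3E^2E^{\pi}F\\ &+\sum_{i=1}^{\infty}F^iF^{\pi}(E^d)^{2i+2}+\sum_{i=1}^{\infty}(F^d)^{i+1}E^{2i}E^{\pi}+\sum_{i=1}^{\infty}F^iF^{\pi}(E^d)^{2i+4}F+\sum_{i=1}^{\infty}(F^d)^{i+3}E^{2i+2}E^{\pi}F,\\ \Lambda={}&FF^{\pi}(E^d)^2+FF^dE^{\pi}+FF^{\pi}(E^d)^4F+(F^d)^2E^2E^{\pi}F-FF^d(E^d)^2F-F^dEE^dF\\ &+\sum_{i=1}^{\infty}F^{i+1}F^{\pi}(E^d)^{2i+2}+\sum_{i=1}^{\infty}(F^d)^iE^{2i}E^{\pi}+\sum_{i=1}^{\infty}F^{i+1}F^{\pi}(E^d)^{2i+4}F+\sum_{i=1}^{\infty}(F^d)^{i+2}E^{2i+2}E^{\pi}F,\\ \Xi={}&-FF^d(E^d)^3F-F^dE^dF+FF^{\pi}(E^d)^3-FF^dE^d+FF^{\pi}(E^d)^5F-(F^d)^2E^2E^dF+(F^d)^2EF\\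 &+\sum_{i=1}^{\infty}F^{i+1}F^{\pi}(E^d)^{2i+3}+\sum_{i=1}^{\infty}(F^d)^iE^{2i-1}E^{\pi}+\sum_{i=1}^{\infty}F^{i+1}F^{\pi}(E^d)^{2i+5}F+\sum_{i=1}^{\infty}(F^d)^{i+2}E^{2i+1}E^{\pi}F. \end{aligned}$$ -/

import Mathlib

open Filter Topology

/-! ### The g-Drazin inverse in a normed ring -/

/-- `a` is quasinilpotent: `‖a ^ n‖ ^ (1 / n) → 0`. -/
def IsQuasinilpotent {A : Type*} [NormedRing A] (a : A) : Prop :=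
  Tendsto (fun n : ℕ => ‖a ^ n‖ ^ (1 / (n : ℝ))) atTop (𝓝 0)

/-- `b` is a g-Drazin inverse of `a`: `ab = ba`, `b = bab`, and `a - a²b` is quasinilpotent. -/
structure IsGDrazinInverse {A : Type*} [NormedRing A] (a b : A) : Prop where
  comm : a * b = b * a
  outer : b = b * a * b
  quasinilpotent : IsQuasinilpotent (a - a ^ 2 * b)

/-- `a` has a g-Drazin inverse. -/
def IsGDrazinInvertible {A : Type*} [NormedRing A] (a : A) : Prop :=
  ∃ b : A, IsGDrazinInverse a b

open Classical in
/-- The g-Drazin inverse `aᵈ` of `a` (unique when it exists, see `IsGDrazinInverse.unique`);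
the value is `0` when `a` has no g-Drazin inverse. -/
noncomputable def gDrazinInv {A : Type*} [NormedRing A] (a : A) : A :=
  if h : IsGDrazinInvertible a then h.choose else 0

postfix:max "ᵈ" => gDrazinInv

/-- The spectral idempotent `a^π = 1 - a aᵈ`, written `aᵖ`. -/
noncomputable def spectralIdem {A : Type*} [NormedRing A] (a : A) : A := 1 - a * aᵈ

postfix:max "ᵖ" => spectralIdem

theorem IsGDrazinInvertible.spec {A : Type*} [NormedRing A] {a : A}
    (h : IsGDrazinInvertible a) : IsGDrazinInverse a aᵈ := by
  unfold gDrazinInv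
  rw [dif_pos h]
  exact h.choose_spec

theorem IsQuasinilpotent.tendsto_mul_pow {A : Type*} [NormedRing A] {a : A}
    (h : IsQuasinilpotent a) {K : ℝ} (hK : 0 ≤ K) :
    Tendsto (fun n : ℕ => K ^ n * ‖a ^ n‖) atTop (𝓝 0) := by
  have h1 : (0 : ℝ) < 1 / (2 * (K + 1)) := by positivity
  have h2 : ∀ᶠ n : ℕ in atTop, K ^ n * ‖a ^ n‖ ≤ (1 / 2 : ℝ) ^ n := by
    filter_upwards [h.eventually (gt_mem_nhds h1), eventually_ge_atTop 1] with n hn hn1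
    have hn0 : (n : ℝ) ≠ 0 := by positivity
    have h3 : ‖a ^ n‖ ≤ (1 / (2 * (K + 1))) ^ n := by
      calc ‖a ^ n‖ = (‖a ^ n‖ ^ (1 / (n : ℝ))) ^ n := by
            rw [← Real.rpow_natCast, ← Real.rpow_mul (norm_nonneg _), one_div_mul_cancel hn0,
              Real.rpow_one]
        _ ≤ _ := by gcongr
    calc K ^ n * ‖a ^ n‖ ≤ K ^ n * (1 / (2 * (K + 1))) ^ n := by gcongr
      _ = (K * (1 / (2 * (K + 1)))) ^ n := (mul_pow _ _ _).symm
      _ ≤ (1 / 2 : ℝ) ^ n := by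
        gcongr
        rw [mul_one_div, div_le_div_iff₀ (by positivity) (by norm_num)]
        linarith
  exact squeeze_zero' (Eventually.of_forall fun n => by positivity) h2
    (tendsto_pow_atTop_nhds_zero_of_lt_one (by norm_num) (by norm_num))

theorem IsGDrazinInverse.mul_eq {A : Type*} [NormedRing A] {a b c : A}
    (hb : IsGDrazinInverse a b) (hc : IsGDrazinInverse a c) :
    c * a * (a * b) = c * a ∧ (a * b) * (c * a) = c * a := by
  have hp : (1 - a * b) * (1 - a * b) = 1 - a * b := by
    have : a * b * (a * b) = a * b := by
      conv_rhs => rw [hb.outer]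
      simp only [mul_assoc]
    rw [mul_sub, sub_mul, sub_mul, this]; simp
  have hcomm : Commute a (1 - a * b) := by
    have : Commute a b := hb.comm
    exact (Commute.one_right a).sub_right ((Commute.refl a).mul_right this)
  have hq : a - a ^ 2 * b = a * (1 - a * b) := by rw [mul_sub, pow_two, mul_assoc, mul_one]
  have hpow : ∀ n : ℕ, (a - a ^ 2 * b) ^ (n + 1) = a ^ (n + 1) * (1 - a * b) := by
    intro n
    have : IsIdempotentElem (1 - a * b) := hp
    rw [hq, hcomm.mul_pow, this.pow_succ_eq]
  have hca : IsIdempotentElem (c * a) := by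
    show c * a * (c * a) = c * a
    conv_rhs => rw [hc.outer]
    simp only [mul_assoc]
  have hcac : Commute c a := hc.comm.symm
  have hT := hb.quasinilpotent.tendsto_mul_pow (norm_nonneg c)
  have hT1 := (tendsto_add_atTop_iff_nat 1).2 hT
  have hca_pow : ∀ n : ℕ, c * a = c ^ (n + 1) * a ^ (n + 1) := fun n => by
    rw [← hcac.mul_pow, hca.pow_succ_eq]
  have hca_pow' : ∀ n : ℕ, c * a = a ^ (n + 1) * c ^ (n + 1) := fun n => by
    rw [hca_pow n, (hcac.pow_pow _ _).eq]
  have hzero : ∀ x : A, (∀ n : ℕ, ‖x‖ ≤ ‖c‖ ^ (n + 1) * ‖(a - a ^ 2 * b) ^ (n + 1)‖) →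
      x = 0 := fun x hx =>
    norm_le_zero_iff.1 (ge_of_tendsto hT1 (Eventually.of_forall hx))
  have e1 : c * a * (1 - a * b) = 0 := hzero _ fun n => by
    rw [hca_pow n, mul_assoc, ← hpow]
    exact (norm_mul_le _ _).trans
      (mul_le_mul_of_nonneg_right (norm_pow_le' _ (Nat.succ_pos n)) (norm_nonneg _))
  have e2 : (1 - a * b) * (c * a) = 0 := hzero _ fun n => by
    rw [hca_pow' n, ← mul_assoc, ← ((hcomm.pow_left (n + 1)).eq), ← hpow, mul_comm (‖c‖ ^ _)]
    exact (norm_mul_le _ _).trans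
      (mul_le_mul_of_nonneg_left (norm_pow_le' _ (Nat.succ_pos n)) (norm_nonneg _))
  constructor
  · rw [mul_sub, mul_one, sub_eq_zero] at e1; exact e1.symm
  · rw [sub_mul, one_mul, sub_eq_zero] at e2; exact e2.symm

/-- The g-Drazin inverse is unique. -/
theorem IsGDrazinInverse.unique {A : Type*} [NormedRing A] {a b c : A}
    (hb : IsGDrazinInverse a b) (hc : IsGDrazinInverse a c) : b = c := by
  have h1 := (hb.mul_eq hc).1
  have h2 := (hc.mul_eq hb).2
  have h : b * a = c * a := by
    rw [← h2, ← h1, hb.comm, hc.comm]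
  calc b = b * a * b := hb.outer
    _ = c * (a * b) := by rw [h, mul_assoc]
    _ = c * (c * a) := by rw [hb.comm, h]
    _ = c * a * c := by rw [← hc.comm, ← mul_assoc, hc.comm]
    _ = c := hc.outer.symm

/-! ### Block operator matrices -/

/-- The block operator matrix `[[A, B], [C, D]]` as a bounded operator on `X × X`. -/
noncomputable def blockOp {X : Type*} [NormedAddCommGroup X] [NormedSpace ℂ X]
    (A B C D : X →L[ℂ] X) : (X × X) →L[ℂ] (X × X) :=
  (A.coprod B).prod (C.coprod D)

theorem blockOp_apply {X : Type*} [NormedAddCommGroup X] [NormedSpace ℂ X]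
    (A B C D : X →L[ℂ] X) (x y : X) :
    blockOp A B C D (x, y) = (A x + B y, C x + D y) := rfl

/-! ### The four entries of the representation

In all series the summation index `i` runs over `i = 1, 2, 3, …`. -/

/-- The entry `Γ`. -/
noncomputable def blockGamma {A : Type*} [NormedRing A] (E F : A) : A :=
  Eᵈ + Eᵈ ^ 3 * F - Fᵈ * Eᵈ * F - Fᵈ ^ 2 * E ^ 2 * Eᵈ * F - F * Fᵈ * Eᵈ + Fᵈ * E * Eᵖ
    + Fᵈ ^ 2 * E * F - F * Fᵈ * Eᵈ ^ 3 * F + Fᵈ ^ 3 * E ^ 3 * Eᵖ * F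
    + ∑' i : ℕ+, F ^ (i : ℕ) * Fᵖ * Eᵈ ^ (2 * (i : ℕ) + 1)
    + ∑' i : ℕ+, Fᵈ ^ ((i : ℕ) + 1) * E ^ (2 * (i : ℕ) + 1) * Eᵖ
    + ∑' i : ℕ+, F ^ (i : ℕ) * Fᵖ * Eᵈ ^ (2 * (i : ℕ) + 3) * F
    + ∑' i : ℕ+, Fᵈ ^ ((i : ℕ) + 3) * E ^ (2 * (i : ℕ) + 3) * Eᵖ * F

/-- The entry `Δ`. -/
noncomputable def blockDelta {A : Type*} [NormedRing A] (E F : A) : A :=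
  Eᵈ ^ 2 + Eᵈ ^ 4 * F - Fᵈ * Eᵈ ^ 2 * F - Fᵈ ^ 2 * E * Eᵈ * F - F * Fᵈ * Eᵈ ^ 2
    + Fᵈ * Eᵖ - F * Fᵈ * Eᵈ ^ 4 * F + Fᵈ ^ 3 * E ^ 2 * Eᵖ * F
    + ∑' i : ℕ+, F ^ (i : ℕ) * Fᵖ * Eᵈ ^ (2 * (i : ℕ) + 2)
    + ∑' i : ℕ+, Fᵈ ^ ((i : ℕ) + 1) * E ^ (2 * (i : ℕ)) * Eᵖ
    + ∑' i : ℕ+, F ^ (i : ℕ) * Fᵖ * Eᵈ ^ (2 * (i : ℕ) + 4) * F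
    + ∑' i : ℕ+, Fᵈ ^ ((i : ℕ) + 3) * E ^ (2 * (i : ℕ) + 2) * Eᵖ * F

/-- The entry `Λ`. -/
noncomputable def blockLambda {A : Type*} [NormedRing A] (E F : A) : A :=
  F * Fᵖ * Eᵈ ^ 2 + F * Fᵈ * Eᵖ + F * Fᵖ * Eᵈ ^ 4 * F + Fᵈ ^ 2 * E ^ 2 * Eᵖ * F
    - F * Fᵈ * Eᵈ ^ 2 * F - Fᵈ * E * Eᵈ * F
    + ∑' i : ℕ+, F ^ ((i : ℕ) + 1) * Fᵖ * Eᵈ ^ (2 * (i : ℕ) + 2)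
    + ∑' i : ℕ+, Fᵈ ^ (i : ℕ) * E ^ (2 * (i : ℕ)) * Eᵖ
    + ∑' i : ℕ+, F ^ ((i : ℕ) + 1) * Fᵖ * Eᵈ ^ (2 * (i : ℕ) + 4) * F
    + ∑' i : ℕ+, Fᵈ ^ ((i : ℕ) + 2) * E ^ (2 * (i : ℕ) + 2) * Eᵖ * F

/-- The entry `Ξ`. -/
noncomputable def blockXi {A : Type*} [NormedRing A] (E F : A) : A :=
  -(F * Fᵈ * Eᵈ ^ 3 * F) - Fᵈ * Eᵈ * F + F * Fᵖ * Eᵈ ^ 3 - F * Fᵈ * Eᵈ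
    + F * Fᵖ * Eᵈ ^ 5 * F - Fᵈ ^ 2 * E ^ 2 * Eᵈ * F + Fᵈ ^ 2 * E * F
    + ∑' i : ℕ+, F ^ ((i : ℕ) + 1) * Fᵖ * Eᵈ ^ (2 * (i : ℕ) + 3)
    + ∑' i : ℕ+, Fᵈ ^ (i : ℕ) * E ^ (2 * (i : ℕ) - 1) * Eᵖ
    + ∑' i : ℕ+, F ^ ((i : ℕ) + 1) * Fᵖ * Eᵈ ^ (2 * (i : ℕ) + 5) * F
    + ∑' i : ℕ+, Fᵈ ^ ((i : ℕ) + 2) * E ^ (2 * (i : ℕ) + 1) * Eᵖ * F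

/-- All sixteen series in `Γ`, `Δ`, `Λ`, `Ξ` converge. -/
structure BlockSeriesSummable {A : Type*} [NormedRing A] (E F : A) : Prop where
  gamma₁ : Summable fun i : ℕ+ => F ^ (i : ℕ) * Fᵖ * Eᵈ ^ (2 * (i : ℕ) + 1)
  gamma₂ : Summable fun i : ℕ+ => Fᵈ ^ ((i : ℕ) + 1) * E ^ (2 * (i : ℕ) + 1) * Eᵖ
  gamma₃ : Summable fun i : ℕ+ => F ^ (i : ℕ) * Fᵖ * Eᵈ ^ (2 * (i : ℕ) + 3) * F
  gamma₄ : Summable fun i : ℕ+ => Fᵈ ^ ((i : ℕ) + 3) * E ^ (2 * (i : ℕ) + 3) * Eᵖ * F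
  delta₁ : Summable fun i : ℕ+ => F ^ (i : ℕ) * Fᵖ * Eᵈ ^ (2 * (i : ℕ) + 2)
  delta₂ : Summable fun i : ℕ+ => Fᵈ ^ ((i : ℕ) + 1) * E ^ (2 * (i : ℕ)) * Eᵖ
  delta₃ : Summable fun i : ℕ+ => F ^ (i : ℕ) * Fᵖ * Eᵈ ^ (2 * (i : ℕ) + 4) * F
  delta₄ : Summable fun i : ℕ+ => Fᵈ ^ ((i : ℕ) + 3) * E ^ (2 * (i : ℕ) + 2) * Eᵖ * F
  lambda₁ : Summable fun i : ℕ+ => F ^ ((i : ℕ) + 1) * Fᵖ * Eᵈ ^ (2 * (i : ℕ) + 2)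
  lambda₂ : Summable fun i : ℕ+ => Fᵈ ^ (i : ℕ) * E ^ (2 * (i : ℕ)) * Eᵖ
  lambda₃ : Summable fun i : ℕ+ => F ^ ((i : ℕ) + 1) * Fᵖ * Eᵈ ^ (2 * (i : ℕ) + 4) * F
  lambda₄ : Summable fun i : ℕ+ => Fᵈ ^ ((i : ℕ) + 2) * E ^ (2 * (i : ℕ) + 2) * Eᵖ * F
  xi₁ : Summable fun i : ℕ+ => F ^ ((i : ℕ) + 1) * Fᵖ * Eᵈ ^ (2 * (i : ℕ) + 3)
  xi₂ : Summable fun i : ℕ+ => Fᵈ ^ (i : ℕ) * E ^ (2 * (i : ℕ) - 1) * Eᵖ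
  xi₃ : Summable fun i : ℕ+ => F ^ ((i : ℕ) + 1) * Fᵖ * Eᵈ ^ (2 * (i : ℕ) + 5) * F
  xi₄ : Summable fun i : ℕ+ => Fᵈ ^ ((i : ℕ) + 2) * E ^ (2 * (i : ℕ) + 1) * Eᵖ * F

/-! An element `a` has a g-Drazin inverse exactly when its resolvent has a Laurent expansion `(z -
a)⁻¹ = ∑ r n * z ^ n` on a punctured disc about `0`, and then `aᵈ = -r 0` and `aᵖ = r (-1)`. So it
suffices to find the resolvent of `M` near `0` and read off its constant coefficient;
`IsGDrazinInverse.unique` identifies the result with `Mᵈ`. All analysis is done on coefficient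
sequences: an identity of functions becomes a recurrence, and convergence becomes `LaurentSummable`.

Put `R = (z - E)⁻¹`, `S = (z ^ 2 - F)⁻¹` and `Q = (z ^ 2 - z * E - F)⁻¹`. Eliminating one component
gives `(z - M)⁻¹ = [[z Q, Q], [F Q, z⁻¹ (1 + F Q)]]` (`isResolventSeq_blockOp`). Since `E F ^ 2 =
0`, `E S = z⁻² E + z⁻⁴ E F`, so `Q = S (1 - z⁻¹ E - z⁻³ E F)⁻¹`. Since `E F E = 0`, `E F R = z⁻¹ E
F`, and the last inverse equals `z R + z⁻² R E F`. With `R E = z R - 1` this yields `Q = z S R + z⁻¹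
S R F - z⁻² S F`, which is `pencilCoeff`; `pencilCoeff_left` and `pencilCoeff_right` verify it on
both sides.

The constant coefficient of `-(z - M)⁻¹` involves only the coefficients of `S R` at the exponents
from `-2` to `2`. Splitting each of these bilateral sums by the signs of the two indices gives the
stated series. -/

/-! ### Laurent coefficients of the resolvent at an isolated point -/

/-- The Laurent series `∑ r n * z ^ n` converges absolutely on a punctured disc around `0`. -/
def LaurentSummable {A : Type*} [NormedRing A] (r : ℤ → A) : Prop :=
  ∃ ε : ℝ, 0 < ε ∧ ∀ ρ : ℝ, 0 < ρ → ρ < ε → Summable fun n : ℤ => ‖r n‖ * ρ ^ n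

namespace LaurentSummable

variable {A : Type*} [NormedRing A] {r s : ℤ → A}

theorem of_norm_le (hr : LaurentSummable r) {C : ℝ} (h : ∀ n, ‖s n‖ ≤ C * ‖r n‖) :
    LaurentSummable s := by
  obtain ⟨ε, hε, H⟩ := hr
  refine ⟨ε, hε, fun ρ h0 h1 => ((H ρ h0 h1).mul_left C).of_nonneg_of_le
    (fun n => by positivity) fun n => ?_⟩
  rw [← mul_assoc]
  exact mul_le_mul_of_nonneg_right (h n) (by positivity)

theorem add (hr : LaurentSummable r) (hs : LaurentSummable s) :
    LaurentSummable fun n => r n + s n := by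
  obtain ⟨ε, hε, H⟩ := hr
  obtain ⟨δ, hδ, K⟩ := hs
  refine ⟨min ε δ, lt_min hε hδ, fun ρ h0 h1 =>
    ((H ρ h0 (h1.trans_le (min_le_left _ _))).add
      (K ρ h0 (h1.trans_le (min_le_right _ _)))).of_nonneg_of_le
    (fun n => by positivity) fun n => ?_⟩
  rw [← add_mul]
  exact mul_le_mul_of_nonneg_right (norm_add_le _ _) (by positivity)

theorem neg (hr : LaurentSummable r) : LaurentSummable fun n => -r n :=
  hr.of_norm_le (C := 1) fun _ => by simp

theorem sub (hr : LaurentSummable r) (hs : LaurentSummable s) :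
    LaurentSummable fun n => r n - s n := by
  simpa only [sub_eq_add_neg] using hr.add hs.neg

theorem mul_right (hr : LaurentSummable r) (a : A) : LaurentSummable fun n => r n * a :=
  hr.of_norm_le (C := ‖a‖) fun n => by rw [mul_comm]; exact norm_mul_le _ _

theorem mul_left (hr : LaurentSummable r) (a : A) : LaurentSummable fun n => a * r n :=
  hr.of_norm_le (C := ‖a‖) fun _ => norm_mul_le _ _

theorem shift (hr : LaurentSummable r) (k : ℤ) : LaurentSummable fun n => r (n + k) := by
  obtain ⟨ε, hε, H⟩ := hr
  refine ⟨ε, hε, fun ρ h0 h1 => ?_⟩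
  have h := ((H ρ h0 h1).comp_injective (add_left_injective k)).mul_right (ρ ^ (-k))
  refine h.congr fun n => ?_
  simp only [Function.comp_apply]
  rw [mul_assoc, ← zpow_add₀ h0.ne']
  congr 2
  ring

theorem single (m : ℤ) (a : A) : LaurentSummable fun n => if n = m then a else 0 := by
  refine ⟨1, one_pos, fun ρ _ _ => summable_of_ne_finset_zero (s := {m}) fun n hn => ?_⟩
  rw [Finset.mem_singleton] at hn
  simp [hn]

/-- Substituting `z ^ 2` for `z`. -/
theorem dilate (hr : LaurentSummable r) :
    LaurentSummable fun n => if Even n then r (n / 2) else 0 := by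
  obtain ⟨ε, hε, H⟩ := hr
  refine ⟨min 1 ε, lt_min one_pos hε, fun ρ h0 h1 => ?_⟩
  have hρ : ρ ^ 2 < ε := by
    have h2 := h1.trans_le (min_le_left _ _)
    have h3 := h1.trans_le (min_le_right _ _)
    nlinarith
  have hinj : Function.Injective fun i : ℤ => 2 * i := fun _ _ h => by simpa using h
  refine (hinj.summable_iff fun _ hn => ?_).1 ((H (ρ ^ 2) (by positivity) hρ).congr fun i => ?_)
  · beta_reduce
    rw [if_neg, norm_zero, zero_mul]
    rintro ⟨k, rfl⟩
    exact hn ⟨k, by ring⟩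
  · simp [zpow_mul]

theorem tendsto_norm_mul_zpow (hr : LaurentSummable r) :
    ∃ ε : ℝ, 0 < ε ∧ ∀ ρ : ℝ, 0 < ρ → ρ < ε →
      Tendsto (fun n : ℤ => ‖r n‖ * ρ ^ n) cofinite (𝓝 0) := by
  obtain ⟨ε, hε, H⟩ := hr
  exact ⟨ε, hε, fun ρ h0 h1 => (H ρ h0 h1).tendsto_cofinite_zero⟩

theorem exists_summable_prod (hr : LaurentSummable r) (hs : LaurentSummable s) :
    ∃ ε : ℝ, 0 < ε ∧ ∀ ρ : ℝ, 0 < ρ → ρ < ε →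
      Summable fun x : ℤ × ℤ => ‖r x.2‖ * ‖s (x.1 - 2 * x.2)‖ * ρ ^ x.1 := by
  obtain ⟨ε, hε, H⟩ := hr
  obtain ⟨δ, hδ, K⟩ := hs
  refine ⟨min 1 (min ε δ), lt_min one_pos (lt_min hε hδ), fun ρ h0 h1 => ?_⟩
  have h2 := h1.trans_le (min_le_left _ _)
  have h3 := (h1.trans_le (min_le_right _ _)).trans_le (min_le_left _ _)
  have h4 := (h1.trans_le (min_le_right _ _)).trans_le (min_le_right _ _)
  have hρ : ρ ^ 2 < ε := by nlinarith
  have h := (H (ρ ^ 2) (by positivity) hρ).mul_of_nonneg (K ρ h0 h4)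
    (fun n => by positivity) (fun n => by positivity)
  have hinj : Function.Injective fun x : ℤ × ℤ => (x.2, x.1 - 2 * x.2) := by
    rintro ⟨a, b⟩ ⟨c, d⟩ hx
    simp only [Prod.mk.injEq] at hx ⊢
    omega
  refine (h.comp_injective hinj).congr fun x => ?_
  simp only [Function.comp_apply]
  have : ρ ^ x.1 = (ρ ^ 2) ^ x.2 * ρ ^ (x.1 - 2 * x.2) := by
    rw [← zpow_natCast, ← zpow_mul, ← zpow_add₀ h0.ne']
    congr 1
    push_cast
    ring
  rw [this]
  ring

/-- The product of the Laurent series of `r` at `z ^ 2` and of `s` at `z`. -/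
theorem conv (hr : LaurentSummable r) (hs : LaurentSummable s) :
    LaurentSummable fun n => ∑' i : ℤ, r i * s (n - 2 * i) := by
  obtain ⟨ε, hε, H⟩ := exists_summable_prod hr hs
  refine ⟨ε, hε, fun ρ h0 h1 => (H ρ h0 h1).prod.of_nonneg_of_le
    (fun n => by positivity) fun n => ?_⟩
  have h := (H ρ h0 h1).comp_injective (Prod.mk_right_injective n)
  beta_reduce
  simp only [tsum_mul_right]
  refine mul_le_mul_of_nonneg_right ?_ (by positivity)
  have hsum : Summable fun i : ℤ => ‖r i‖ * ‖s (n - 2 * i)‖ := by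
    refine (h.mul_right (ρ ^ (-n))).congr fun i => ?_
    simp only [Function.comp_apply]
    rw [mul_assoc, ← zpow_add₀ h0.ne', add_neg_cancel, zpow_zero, mul_one]
  -- Completeness is not needed: a divergent `tsum` is `0`, which also satisfies the bound.
  exact tsum_of_norm_bounded hsum.hasSum fun i => norm_mul_le _ _

theorem summable_mul [CompleteSpace A] (hr : LaurentSummable r) (hs : LaurentSummable s) (n : ℤ) :
    Summable fun i : ℤ => r i * s (n - 2 * i) := by
  obtain ⟨ε, hε, H⟩ := exists_summable_prod hr hs
  have h := (H (ε / 2) (by positivity) (by linarith)).comp_injective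
    (Prod.mk_right_injective n)
  have h' := h.mul_right ((ε / 2) ^ (-n))
  refine Summable.of_norm_bounded h' fun i => ?_
  simp only [Function.comp_apply]
  rw [mul_assoc, ← zpow_add₀ (by positivity), add_neg_cancel, zpow_zero, mul_one]
  exact norm_mul_le _ _

end LaurentSummable

/-! ### The g-Drazin inverse as a Laurent coefficient -/

/-- `r` is the sequence of Laurent coefficients at `0` of the resolvent `z ↦ (z - a)⁻¹`. -/
structure IsResolventSeq {A : Type*} [NormedRing A] (a : A) (r : ℤ → A) : Prop where
  left : ∀ n, r (n - 1) - a * r n = if n = 0 then 1 else 0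
  right : ∀ n, r (n - 1) - r n * a = if n = 0 then 1 else 0
  summable : LaurentSummable r

namespace IsResolventSeq

variable {A : Type*} [NormedRing A] {a : A} {r : ℤ → A}

theorem mul_of_ne (h : IsResolventSeq a r) {n : ℤ} (hn : n ≠ 0) : a * r n = r (n - 1) := by
  have := h.left n
  rw [if_neg hn, sub_eq_zero] at this
  exact this.symm

theorem mul_of_ne' (h : IsResolventSeq a r) {n : ℤ} (hn : n ≠ 0) : r n * a = r (n - 1) := by
  have := h.right n
  rw [if_neg hn, sub_eq_zero] at this
  exact this.symm

theorem pow_mul (h : IsResolventSeq a r) (n : ℕ) : a ^ n * r (-1) = r (-n - 1) := by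
  induction n with
  | zero => simp
  | succ n ih =>
    rw [pow_succ', mul_assoc, ih, h.mul_of_ne (by omega)]
    congr 1
    push_cast
    ring

theorem mul_pow (h : IsResolventSeq a r) (n : ℕ) : r n * a ^ n = r 0 := by
  induction n with
  | zero => simp
  | succ n ih =>
    rw [pow_succ', ← mul_assoc, h.mul_of_ne' (by omega)]
    simpa using ih

/-- For every `n`, `r 0 * r (-1) = r n * a ^ n * r (-1) = r n * r (-n - 1)`. The weights `ρ ^ n` and
`ρ ^ (-n - 1)` multiply to the constant `ρ⁻¹`, so the norm is bounded by a product of two null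
sequences. -/
theorem zero_mul_neg_one (h : IsResolventSeq a r) : r 0 * r (-1) = 0 := by
  obtain ⟨ε, hε, H⟩ := h.summable.tendsto_norm_mul_zpow
  have hρ : 0 < ε / 2 := by positivity
  have hT := H (ε / 2) hρ (by linarith)
  have h1 := hT.comp (Nat.cast_injective (R := ℤ)).tendsto_cofinite
  have hinj : Function.Injective fun n : ℕ => -(n : ℤ) - 1 := fun _ _ h => by
    simpa using h
  have h2 := hT.comp hinj.tendsto_cofinite
  have h3 := (h1.mul h2).mul_const (ε / 2)
  rw [Nat.cofinite_eq_atTop, mul_zero, zero_mul] at h3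
  refine norm_le_zero_iff.1 (ge_of_tendsto h3 (Eventually.of_forall fun n => ?_))
  rw [← h.mul_pow n, mul_assoc, h.pow_mul]
  refine (norm_mul_le _ _).trans_eq ?_
  change _ = ‖r n‖ * (ε / 2) ^ (n : ℤ) * (‖r (-n - 1)‖ * (ε / 2) ^ (-(n : ℤ) - 1)) * (ε / 2)
  have : (ε / 2) ^ (n : ℤ) * (ε / 2) ^ (-(n : ℤ) - 1) * (ε / 2) = 1 := by
    rw [← zpow_add₀ hρ.ne', ← zpow_add_one₀ hρ.ne', add_sub_assoc', add_neg_cancel, zero_sub,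
      neg_add_cancel, zpow_zero]
  linear_combination (-‖r n‖ * ‖r (-n - 1)‖) * this

theorem neg_one_eq (h : IsResolventSeq a r) : r (-1) = 1 - a * -r 0 := by
  have := h.left 0
  rw [if_pos rfl, zero_sub, sub_eq_iff_eq_add] at this
  rw [this]
  noncomm_ring

theorem comm_zero (h : IsResolventSeq a r) : a * r 0 = r 0 * a :=
  sub_right_injective ((h.left 0).trans (h.right 0).symm)

/-- `r (-1)` is an idempotent commuting with `a`, so the powers of `a * r (-1)` are the coefficients
`r (-n - 1)`. These are eventually below `ρ ^ n` for every small `ρ`. -/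
theorem isQuasinilpotent (h : IsResolventSeq a r) : IsQuasinilpotent (a * r (-1)) := by
  have hcomm : Commute a (r (-1)) := by
    rw [h.neg_one_eq]
    exact (Commute.one_right a).sub_right ((Commute.refl a).mul_right
      (Commute.neg_right h.comm_zero))
  have hidem : IsIdempotentElem (r (-1)) := by
    have h0 := h.zero_mul_neg_one
    show r (-1) * r (-1) = r (-1)
    nth_rewrite 1 [h.neg_one_eq]
    rw [sub_mul, one_mul, mul_assoc, neg_mul, h0, neg_zero, mul_zero, sub_zero]
  have hpow : ∀ n : ℕ, n ≠ 0 → (a * r (-1)) ^ n = r (-n - 1) := by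
    intro n hn
    obtain ⟨m, rfl⟩ := Nat.exists_eq_succ_of_ne_zero hn
    rw [hcomm.mul_pow, hidem.pow_succ_eq, h.pow_mul]
  obtain ⟨ε, hε, H⟩ := h.summable.tendsto_norm_mul_zpow
  rw [IsQuasinilpotent, Metric.tendsto_nhds]
  intro δ hδ
  -- `ρ < ε` gives convergence, `ρ < δ` the final bound, and `ρ < 1` absorbs the surplus factor in
  -- `ρ ^ (n + 1)`.
  obtain ⟨ρ, h0, h1⟩ := exists_between (lt_min (lt_min hε hδ) one_pos)
  have hρε := (h1.trans_le (min_le_left _ _)).trans_le (min_le_left _ _)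
  have hρδ := (h1.trans_le (min_le_left _ _)).trans_le (min_le_right _ _)
  have hρ1 := h1.trans_le (min_le_right _ _)
  have hinj : Function.Injective fun n : ℕ => -(n : ℤ) - 1 := fun _ _ h => by
    simpa using h
  have hT := (H ρ h0 hρε).comp hinj.tendsto_cofinite
  rw [Nat.cofinite_eq_atTop] at hT
  filter_upwards [hT.eventually (gt_mem_nhds one_pos), eventually_ge_atTop 1] with n hn hn1
  simp only [Function.comp_apply] at hn
  have hn0 : (n : ℝ) ≠ 0 := by positivity
  have hle : ‖(a * r (-1)) ^ n‖ ≤ ρ ^ n := by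
    rw [hpow n (by omega)]
    have e : ρ ^ (-(n : ℤ) - 1) * ρ ^ (n + 1) = 1 := by
      rw [← zpow_natCast, ← zpow_add₀ h0.ne']
      simp
    calc ‖r (-n - 1)‖ = ‖r (-n - 1)‖ * ρ ^ (-(n : ℤ) - 1) * ρ ^ (n + 1) := by
          rw [mul_assoc, e, mul_one]
      _ ≤ 1 * ρ ^ (n + 1) := mul_le_mul_of_nonneg_right hn.le (by positivity)
      _ ≤ ρ ^ n := by
        rw [one_mul]
        exact pow_le_pow_of_le_one h0.le hρ1.le (Nat.le_succ n)
  rw [Real.dist_eq, sub_zero, abs_of_nonneg (by positivity)]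
  calc ‖(a * r (-1)) ^ n‖ ^ (1 / (n : ℝ)) ≤ (ρ ^ n) ^ (1 / (n : ℝ)) := by gcongr
    _ = ρ := by
      rw [← Real.rpow_natCast, ← Real.rpow_mul h0.le, mul_one_div_cancel hn0, Real.rpow_one]
    _ < δ := hρδ

theorem isGDrazinInverse (h : IsResolventSeq a r) : IsGDrazinInverse a (-r 0) where
  comm := by rw [mul_neg, neg_mul, h.comm_zero]
  outer := by
    have := h.zero_mul_neg_one
    rw [h.neg_one_eq, mul_sub, mul_one, sub_eq_zero] at this
    nth_rewrite 1 [this]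
    noncomm_ring
  quasinilpotent := by
    have e : a - a ^ 2 * -r 0 = a * r (-1) := by
      rw [h.neg_one_eq, mul_sub, mul_one, pow_two, mul_assoc]
    rw [e]
    exact h.isQuasinilpotent

end IsResolventSeq

/-! ### Laurent expansion of the resolvent of a g-Drazin invertible element -/

/-- The Laurent coefficients at `0` of the resolvent of `a`, in terms of `aᵈ` and `aᵖ`. -/
noncomputable def resolventCoeff {A : Type*} [NormedRing A] (a : A) : ℤ → A
  | Int.ofNat n => -aᵈ ^ (n + 1)
  | Int.negSucc n => a ^ n * aᵖ

theorem resolventCoeff_of_nonneg {A : Type*} [NormedRing A] (a : A) {n : ℤ} (m : ℕ) (h : n + 1 = m) (hm : m ≠ 0) :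
    resolventCoeff a n = -aᵈ ^ m := by
  obtain ⟨k, rfl⟩ := Nat.exists_eq_succ_of_ne_zero hm
  obtain rfl : n = Int.ofNat k := by simp; omega
  rfl

theorem resolventCoeff_of_neg {A : Type*} [NormedRing A] (a : A) {n : ℤ} (m : ℕ) (h : n = -m - 1) :
    resolventCoeff a n = a ^ m * aᵖ := by
  obtain rfl : n = Int.negSucc m := by omega
  rfl

namespace IsGDrazinInvertible

variable {A : Type*} [NormedRing A] {a : A}

theorem commute (h : IsGDrazinInvertible a) : Commute a aᵈ := h.spec.comm

theorem mul_inv_sq (h : IsGDrazinInvertible a) : a * aᵈ ^ 2 = aᵈ := by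
  conv_rhs => rw [h.spec.outer, ← h.commute.eq]
  rw [pow_two, mul_assoc]

theorem commute_idem (h : IsGDrazinInvertible a) : Commute a aᵖ :=
  (Commute.one_right a).sub_right ((Commute.refl a).mul_right h.commute)

theorem isIdempotentElem (h : IsGDrazinInvertible a) : IsIdempotentElem aᵖ := by
  apply IsIdempotentElem.one_sub
  show a * aᵈ * (a * aᵈ) = a * aᵈ
  conv_rhs => rw [h.spec.outer]
  simp only [mul_assoc]

theorem commute_resolventCoeff (h : IsGDrazinInvertible a) (n : ℤ) :
    Commute a (resolventCoeff a n) := by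
  rcases n with n | n
  · exact (h.commute.pow_right _).neg_right
  · exact ((Commute.refl a).pow_right n).mul_right h.commute_idem

theorem resolventCoeff_left (h : IsGDrazinInvertible a) (n : ℤ) :
    resolventCoeff a (n - 1) - a * resolventCoeff a n = if n = 0 then 1 else 0 := by
  rcases lt_trichotomy n 0 with hn | rfl | hn
  · obtain ⟨m, rfl⟩ : ∃ m : ℕ, n = -m - 1 := ⟨(-n - 1).toNat, by omega⟩
    rw [if_neg hn.ne, resolventCoeff_of_neg a m rfl,
      resolventCoeff_of_neg a (m + 1) (by push_cast; ring), pow_succ', mul_assoc, sub_self]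
  · rw [if_pos rfl, resolventCoeff_of_neg a 0 (by simp),
      resolventCoeff_of_nonneg a 1 (by simp) one_ne_zero, spectralIdem]
    simp
  · obtain ⟨m, rfl⟩ : ∃ m : ℕ, n = m + 1 := ⟨(n - 1).toNat, by omega⟩
    rw [if_neg hn.ne', resolventCoeff_of_nonneg a (m + 1) (by simp) (by simp),
      resolventCoeff_of_nonneg a (m + 2) (by push_cast; ring) (by simp),
      show m + 2 = 2 + m by ring, pow_add _ 2 m, mul_neg, ← mul_assoc, h.mul_inv_sq, pow_succ',
      sub_self]

/-- The regular part is dominated by a geometric series of ratio `‖aᵈ‖ * ρ < 1`. The principal part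
converges for every `ρ > 0`, because `a * aᵖ` is quasinilpotent: taking `K = 2 / ρ` leaves a
geometric series of ratio `1 / 2`. -/
theorem summable_resolventCoeff (h : IsGDrazinInvertible a) :
    LaurentSummable (resolventCoeff a) := by
  refine ⟨1 / (‖aᵈ‖ + 1), by positivity, fun ρ h0 h1 => ?_⟩
  rw [lt_div_iff₀ (by positivity)] at h1
  refine Summable.of_nat_of_neg_add_one ?_ ?_
  · have hq : ‖aᵈ‖ * ρ < 1 := by nlinarith
    refine ((summable_geometric_of_lt_one (by positivity) hq).mul_left ‖aᵈ‖).of_nonneg_of_le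
      (fun n => by positivity) fun n => ?_
    rw [resolventCoeff_of_nonneg a (n + 1) (by simp) (by simp), norm_neg, zpow_natCast]
    calc ‖aᵈ ^ (n + 1)‖ * ρ ^ n ≤ ‖aᵈ‖ ^ (n + 1) * ρ ^ n :=
          mul_le_mul_of_nonneg_right (norm_pow_le' _ (Nat.succ_pos n)) (by positivity)
      _ = _ := by ring
  · have hT := h.spec.quasinilpotent.tendsto_mul_pow (K := 2 / ρ) (by positivity)
    -- The first term is dropped because `(a * aᵖ) ^ n = a ^ n * aᵖ` requires `n ≥ 1`.
    rw [← summable_nat_add_iff 1]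
    have hq : ∀ n : ℕ, (a - a ^ 2 * aᵈ) ^ (n + 1) = a ^ (n + 1) * aᵖ := by
      intro n
      have e : a - a ^ 2 * aᵈ = a * aᵖ := by
        rw [spectralIdem, mul_sub, pow_two, mul_assoc, mul_one]
      rw [e, h.commute_idem.mul_pow, h.isIdempotentElem.pow_succ_eq]
    obtain ⟨C, hC⟩ := hT.bddAbove_range
    refine ((summable_geometric_of_lt_one (r := (1 / 2 : ℝ)) (by norm_num)
      (by norm_num)).mul_left (C / ρ)).of_nonneg_of_le (fun n => by positivity) fun n => ?_
    have hCn := hC ⟨n + 1, rfl⟩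
    simp only [hq] at hCn
    rw [resolventCoeff_of_neg a (n + 1) (by push_cast; ring)]
    have e : ρ ^ (-(((n + 1 : ℕ) : ℤ) + 1)) = (2 / ρ) ^ (n + 1) * ((1 / 2) ^ n * (1 / 2 / ρ)) := by
      rw [zpow_neg, ← Nat.cast_succ, zpow_natCast, div_pow, div_pow, one_pow, Nat.succ_eq_add_one]
      field_simp
      ring
    rw [e]
    have : 0 ≤ C := le_trans (by positivity) hCn
    calc _ = ((2 / ρ) ^ (n + 1) * ‖a ^ (n + 1) * aᵖ‖) * ((1 / 2) ^ n * (1 / 2 / ρ)) := by ring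
      _ ≤ C * ((1 / 2) ^ n * (1 / 2 / ρ)) := mul_le_mul_of_nonneg_right hCn (by positivity)
      _ ≤ C / ρ * (1 / 2) ^ n := by
        have : 0 ≤ C / ρ * (1 / 2) ^ n := by positivity
        have e : C * ((1 / 2) ^ n * (1 / 2 / ρ)) = C / ρ * (1 / 2) ^ n / 2 := by ring
        linarith

theorem isResolventSeq (h : IsGDrazinInvertible a) : IsResolventSeq a (resolventCoeff a) where
  left := h.resolventCoeff_left
  right n := by rw [← (h.commute_resolventCoeff n).eq, h.resolventCoeff_left]
  summable := h.summable_resolventCoeff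

end IsGDrazinInvertible

/-! ### The quadratic pencil `z ^ 2 - z * E - F` -/

/-- The Laurent coefficients at `0` of `(z ^ 2 - F)⁻¹`. -/
noncomputable def sqCoeff {A : Type*} [NormedRing A] (F : A) (n : ℤ) : A :=
  if Even n then resolventCoeff F (n / 2) else 0

/-- The Laurent coefficients at `0` of `(z ^ 2 - F)⁻¹ * (z - E)⁻¹`. -/
noncomputable def convCoeff {A : Type*} [NormedRing A] (E F : A) (n : ℤ) : A :=
  ∑' i : ℤ, resolventCoeff F i * resolventCoeff E (n - 2 * i)

/-- The Laurent coefficients at `0` of `(z ^ 2 - z * E - F)⁻¹` when `E * F ^ 2 = 0` and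
`E * F * E = 0`. -/
noncomputable def pencilCoeff {A : Type*} [NormedRing A] (E F : A) (n : ℤ) : A :=
  convCoeff E F (n - 1) + convCoeff E F (n + 1) * F - sqCoeff F (n + 2) * F

section Pencil

variable {A : Type*} [NormedRing A] {E F : A}

theorem sqCoeff_two_mul (F : A) (n : ℤ) : sqCoeff F (2 * n) = resolventCoeff F n := by
  simp [sqCoeff]

theorem sqCoeff_of_not_even (F : A) {n : ℤ} (hn : ¬Even n) : sqCoeff F n = 0 := if_neg hn

theorem sqCoeff_sub_mul (hF : IsGDrazinInvertible F) (n : ℤ) :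
    sqCoeff F (n - 2) - sqCoeff F n * F = if n = 0 then 1 else 0 := by
  rcases Int.even_or_odd' n with ⟨k, rfl | rfl⟩
  · rw [show 2 * k - 2 = 2 * (k - 1) by ring, sqCoeff_two_mul, sqCoeff_two_mul,
      hF.isResolventSeq.right]
    simp
  · rw [sqCoeff_of_not_even F (n := 2 * k + 1) (by simp),
      sqCoeff_of_not_even F (by rw [Int.not_even_iff_odd]; exact ⟨k - 1, by ring⟩),
      if_neg (by omega), zero_mul, sub_zero]

theorem sqCoeff_sub_mul' (hF : IsGDrazinInvertible F) (n : ℤ) :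
    sqCoeff F (n - 2) - F * sqCoeff F n = if n = 0 then 1 else 0 := by
  rw [← sqCoeff_sub_mul hF]
  congr 1
  unfold sqCoeff
  split_ifs
  · exact (hF.commute_resolventCoeff _).eq
  · simp

/-- `Fᵈ = F ^ 2 * Fᵈ ^ 3`. -/
theorem mul_gDrazinInv_eq_zero (hF : IsGDrazinInvertible F) (hEFF : E * F ^ 2 = 0) :
    E * Fᵈ = 0 := by
  have h : F ^ 2 * Fᵈ ^ 3 = Fᵈ := by
    rw [pow_two, show 3 = 2 + 1 from rfl, pow_succ, mul_assoc, ← mul_assoc F (Fᵈ ^ 2),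
      hF.mul_inv_sq, ← pow_two, hF.mul_inv_sq]
  rw [← h, ← mul_assoc, hEFF, zero_mul]

/-- Coefficient form of `E (z - F)⁻¹ = z⁻¹ E + z⁻² E F`: multiplication by `E` makes the resolvent
of `F` a Laurent polynomial. -/
theorem mul_resolventCoeff (hF : IsGDrazinInvertible F) (hEFF : E * F ^ 2 = 0) (n : ℤ) :
    E * resolventCoeff F n = if n = -1 then E else if n = -2 then E * F else 0 := by
  have h := mul_gDrazinInv_eq_zero hF hEFF
  have hπ : E * Fᵖ = E := by
    rw [spectralIdem, hF.commute.eq, mul_sub, ← mul_assoc, h, zero_mul, sub_zero, mul_one]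
  rcases n with n | n
  · rw [if_neg (by simp), if_neg (by simp)]
    show E * -Fᵈ ^ (n + 1) = 0
    rw [pow_succ', mul_neg, ← mul_assoc, h, zero_mul, neg_zero]
  · show E * (F ^ n * Fᵖ) = _
    rw [(hF.commute_idem.pow_left n).eq, ← mul_assoc, hπ]
    rcases n with _ | _ | n
    · simp
    · simp
    · rw [if_neg (by omega), if_neg (by omega), show n + 1 + 1 = 2 + n by ring, pow_add,
        ← mul_assoc, hEFF, zero_mul]

theorem mul_mul_resolventCoeff (hE : IsGDrazinInvertible E) (hEFE : E * F * E = 0) (n : ℤ) :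
    E * F * resolventCoeff E n = if n = -1 then E * F else 0 := by
  have h : E * F * Eᵈ = 0 := by
    rw [← hE.mul_inv_sq, ← mul_assoc, hEFE, zero_mul]
  rcases n with n | n
  · rw [if_neg (by simp)]
    show E * F * -Eᵈ ^ (n + 1) = 0
    rw [pow_succ', mul_neg, ← mul_assoc, h, zero_mul, neg_zero]
  · show E * F * (E ^ n * Eᵖ) = _
    rcases n with _ | n
    · simp [spectralIdem, mul_sub, ← mul_assoc, hEFE]
    · rw [if_neg (by omega), pow_succ', ← mul_assoc, ← mul_assoc, hEFE, zero_mul, zero_mul]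

theorem mul_sqCoeff (hF : IsGDrazinInvertible F) (hEFF : E * F ^ 2 = 0) (n : ℤ) :
    E * sqCoeff F n = if n = -2 then E else if n = -4 then E * F else 0 := by
  unfold sqCoeff
  by_cases hn : Even n
  · rw [if_pos hn, mul_resolventCoeff hF hEFF]
    obtain ⟨k, rfl⟩ := hn
    rw [← two_mul, Int.mul_ediv_cancel_left _ two_ne_zero]
    congr 1
    · simp; omega
    · congr 1
      simp; omega
  · rw [if_neg hn, if_neg, if_neg, mul_zero]
    · rintro rfl
      exact hn ⟨-2, rfl⟩
    · rintro rfl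
      exact hn ⟨-1, rfl⟩

theorem summable_pencilCoeff (hE : IsGDrazinInvertible E) (hF : IsGDrazinInvertible F) :
    LaurentSummable (pencilCoeff E F) := by
  have hc : LaurentSummable (convCoeff E F) :=
    hF.summable_resolventCoeff.conv hE.summable_resolventCoeff
  exact ((hc.shift (-1)).add ((hc.shift 1).mul_right F)).sub
    ((hF.summable_resolventCoeff.dilate.shift 2).mul_right F)

variable [CompleteSpace A]

theorem summable_conv (hE : IsGDrazinInvertible E) (hF : IsGDrazinInvertible F) (n : ℤ) :
    Summable fun i : ℤ => resolventCoeff F i * resolventCoeff E (n - 2 * i) :=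
  hF.summable_resolventCoeff.summable_mul hE.summable_resolventCoeff n

/-- Coefficient form of `(z ^ 2 - F) S R = R`: after shifting the index, the two sums differ only at
`i = 0`. -/
theorem convCoeff_sub_mul_left (hE : IsGDrazinInvertible E) (hF : IsGDrazinInvertible F)
    (n : ℤ) : convCoeff E F (n - 2) - F * convCoeff E F n = resolventCoeff E n := by
  have h1 : convCoeff E F (n - 2) =
      ∑' i : ℤ, resolventCoeff F (i - 1) * resolventCoeff E (n - 2 * i) := by
    rw [convCoeff, ← (Equiv.subRight (1 : ℤ)).tsum_eq]
    refine tsum_congr fun i => ?_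
    simp only [Equiv.subRight_apply]
    congr 2
    ring
  have h2 : Summable fun i : ℤ => resolventCoeff F (i - 1) * resolventCoeff E (n - 2 * i) := by
    refine ((Equiv.subRight (1 : ℤ)).summable_iff.2 (summable_conv hE hF (n - 2))).congr
      fun i => ?_
    simp only [Function.comp_apply, Equiv.subRight_apply]
    congr 2
    ring
  rw [h1, convCoeff, ← (summable_conv hE hF n).tsum_mul_left,
    ← h2.tsum_sub ((summable_conv hE hF n).mul_left F), tsum_eq_single 0]
  · rw [← mul_assoc, ← sub_mul, hF.isResolventSeq.left]
    simp
  · intro i hi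
    rw [← mul_assoc, ← sub_mul, hF.isResolventSeq.left, if_neg hi, zero_mul]

theorem convCoeff_sub_mul_right (hE : IsGDrazinInvertible E) (hF : IsGDrazinInvertible F)
    (n : ℤ) : convCoeff E F (n - 1) - convCoeff E F n * E = sqCoeff F n := by
  have e : ∀ i : ℤ, resolventCoeff F i * resolventCoeff E (n - 1 - 2 * i) -
      resolventCoeff F i * resolventCoeff E (n - 2 * i) * E =
      if n = 2 * i then resolventCoeff F i else 0 := fun i => by
    rw [mul_assoc, ← mul_sub, sub_right_comm, hE.isResolventSeq.right]
    simp only [sub_eq_zero, mul_ite, mul_one, mul_zero]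
  rw [convCoeff, convCoeff, ← (summable_conv hE hF n).tsum_mul_right,
    ← (summable_conv hE hF (n - 1)).tsum_sub ((summable_conv hE hF n).mul_right E)]
  simp only [e]
  rcases Int.even_or_odd' n with ⟨k, rfl | rfl⟩
  · rw [tsum_eq_single k fun i hi => if_neg (by omega), if_pos rfl, sqCoeff_two_mul]
  · rw [sqCoeff_of_not_even F (by simp)]
    convert tsum_zero with i
    rw [if_neg (by omega)]

/-- Coefficient form of `E S R = z⁻² E R + z⁻⁵ E F`. Only `i = -1` and `i = -2` survive
multiplication by `E`, and the second meets `E F R = z⁻¹ E F`. -/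
theorem mul_convCoeff (hE : IsGDrazinInvertible E) (hF : IsGDrazinInvertible F)
    (hEFF : E * F ^ 2 = 0) (hEFE : E * F * E = 0) (n : ℤ) :
    E * convCoeff E F n =
      E * resolventCoeff E (n + 2) + if n + 5 = 0 then E * F else 0 := by
  rw [convCoeff, ← (summable_conv hE hF n).tsum_mul_left]
  simp only [← mul_assoc, mul_resolventCoeff hF hEFF]
  rw [tsum_eq_sum (s := {-1, -2})]
  · rw [Finset.sum_pair (by norm_num)]
    simp only [if_true, show ¬((-2 : ℤ) = -1) by norm_num, if_false,
      mul_mul_resolventCoeff hE hEFE]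
    rw [show n - 2 * -1 = n + 2 by ring]
    congr 1
    refine if_congr ?_ rfl rfl
    omega
  · intro i hi
    simp only [Finset.mem_insert, Finset.mem_singleton, not_or] at hi
    rw [if_neg hi.1, if_neg hi.2, zero_mul]

/-- The factor `z ^ 2 - F` cancels `S`, and the terms with `E` on the left are then explicit. The
stray `E F` at `n = -3`, coming from `E S R`, cancels against the one from `E S F`; the remaining
stray terms contain `E F ^ 2`. -/
theorem pencilCoeff_left (hE : IsGDrazinInvertible E) (hF : IsGDrazinInvertible F)
    (hEFF : E * F ^ 2 = 0) (hEFE : E * F * E = 0) (n : ℤ) :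
    pencilCoeff E F (n - 2) - E * pencilCoeff E F (n - 1) - F * pencilCoeff E F n =
      if n = 0 then 1 else 0 := by
  have h1 := convCoeff_sub_mul_left hE hF (n - 1)
  have h2 := convCoeff_sub_mul_left hE hF (n + 1)
  have h3 := sqCoeff_sub_mul' hF (n + 2)
  have h4 := mul_convCoeff hE hF hEFF hEFE (n - 2)
  have h5 := mul_convCoeff hE hF hEFF hEFE n
  have h6 := mul_sqCoeff hF hEFF (n + 1)
  have h7 := hE.isResolventSeq.left n
  have h8 := hE.isResolventSeq.left (n + 2)
  have h9 : (E * sqCoeff F (n + 1)) * F = if n + 3 = 0 then E * F else 0 := by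
    rw [h6]
    by_cases h : n + 3 = 0
    · rw [if_pos (by omega), if_pos h]
    · rw [if_neg (by omega), if_neg h]
      split_ifs
      · rw [mul_assoc, ← pow_two, hEFF]
      · simp
  have h10 : (if n + 5 = 0 then E * F else 0) * F = 0 := by
    split_ifs
    · rw [mul_assoc, ← pow_two, hEFF]
    · simp
  simp only [show n - 2 + 2 = n by ring, show n - 2 + 5 = n + 3 by ring,
    show n + 2 - 2 = n by ring, show n - 1 - 2 = n - 3 by ring,
    show n + 1 - 2 = n - 1 by ring, show n + 2 - 1 = n + 1 by ring] at h1 h2 h3 h4 h5 h8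
  unfold pencilCoeff
  simp only [show n - 2 - 1 = n - 3 by ring, show n - 2 + 1 = n - 1 by ring,
    show n - 2 + 2 = n by ring, show n - 1 - 1 = n - 2 by ring,
    show n - 1 + 1 = n by ring, show n - 1 + 2 = n + 1 by ring]
  calc _ = (convCoeff E F (n - 3) - F * convCoeff E F (n - 1)) +
        (convCoeff E F (n - 1) - F * convCoeff E F (n + 1)) * F -
        (sqCoeff F n - F * sqCoeff F (n + 2)) * F - E * convCoeff E F (n - 2) -
        E * convCoeff E F n * F + E * sqCoeff F (n + 1) * F := by noncomm_ring
    _ = (resolventCoeff E (n - 1) - E * resolventCoeff E n) +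
        (resolventCoeff E (n + 1) - E * resolventCoeff E (n + 2)) * F -
        (if n + 2 = 0 then 1 else 0) * F - (if n + 5 = 0 then E * F else 0) * F := by
      rw [h1, h2, h3, h4, h5, h9]
      noncomm_ring
    _ = _ := by
      rw [h7, h8, h10]
      noncomm_ring

/-- Here `S R (z - E) = S` suffices: the obstructions to `Q` being a left inverse are multiples of
`E F E` and `E F ^ 2`. -/
theorem pencilCoeff_right (hE : IsGDrazinInvertible E) (hF : IsGDrazinInvertible F)
    (hEFF : E * F ^ 2 = 0) (hEFE : E * F * E = 0) (n : ℤ) :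
    pencilCoeff E F (n - 2) - pencilCoeff E F (n - 1) * E - pencilCoeff E F n * F =
      if n = 0 then 1 else 0 := by
  have h1 := convCoeff_sub_mul_right hE hF (n - 2)
  have h2 := convCoeff_sub_mul_right hE hF (n + 1)
  have h3 := convCoeff_sub_mul_right hE hF (n + 2)
  have h4 := sqCoeff_sub_mul hF n
  simp only [show n - 2 - 1 = n - 3 by ring, show n + 1 - 1 = n by ring,
    show n + 2 - 1 = n + 1 by ring] at h1 h2 h3
  rw [sub_eq_iff_eq_add] at h1 h2 h3
  unfold pencilCoeff
  simp only [show n - 2 - 1 = n - 3 by ring, show n - 2 + 1 = n - 1 by ring,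
    show n - 2 + 2 = n by ring, show n - 1 - 1 = n - 2 by ring,
    show n - 1 + 1 = n by ring, show n - 1 + 2 = n + 1 by ring]
  calc _ = (sqCoeff F (n - 2) - sqCoeff F n * F) - convCoeff E F (n + 1) * (E * F * E) -
        convCoeff E F (n + 2) * (E * F ^ 2) := by
        rw [h1, h2, h3]
        noncomm_ring
    _ = _ := by rw [h4, hEFE, hEFF, mul_zero, mul_zero, sub_zero, sub_zero]

end Pencil

/-! ### Block operators -/

section Block

variable {X : Type*} [NormedAddCommGroup X] [NormedSpace ℂ X]

theorem blockOp_mul (A B C D A' B' C' D' : X →L[ℂ] X) :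
    blockOp A B C D * blockOp A' B' C' D' =
      blockOp (A * A' + B * C') (A * B' + B * D') (C * A' + D * C') (C * B' + D * D') := by
  ext x <;> simp [blockOp]

theorem blockOp_sub (A B C D A' B' C' D' : X →L[ℂ] X) :
    blockOp A B C D - blockOp A' B' C' D' =
      blockOp (A - A') (B - B') (C - C') (D - D') := by
  ext x <;> simp [blockOp]

theorem blockOp_neg (A B C D : X →L[ℂ] X) :
    -blockOp A B C D = blockOp (-A) (-B) (-C) (-D) := by
  ext x <;> simp [blockOp]

theorem blockOp_one : blockOp (1 : X →L[ℂ] X) 0 0 1 = 1 := by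
  ext x <;> simp [blockOp]

theorem blockOp_zero : blockOp (0 : X →L[ℂ] X) 0 0 0 = 0 := by
  ext x <;> simp [blockOp]

theorem norm_blockOp_le (A B C D : X →L[ℂ] X) :
    ‖blockOp A B C D‖ ≤ ‖A‖ + ‖B‖ + ‖C‖ + ‖D‖ := by
  refine ContinuousLinearMap.opNorm_le_bound _ (by positivity) fun x => ?_
  obtain ⟨x, y⟩ := x
  have hx : ‖x‖ ≤ ‖(x, y)‖ := norm_fst_le (x, y)
  have hy : ‖y‖ ≤ ‖(x, y)‖ := norm_snd_le (x, y)
  have h (T : X →L[ℂ] X) {z : X} (hz : ‖z‖ ≤ ‖(x, y)‖) : ‖T z‖ ≤ ‖T‖ * ‖(x, y)‖ :=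
    (T.le_opNorm z).trans (mul_le_mul_of_nonneg_left hz (norm_nonneg _))
  have hA := h A hx
  have hB := h B hy
  have hC := h C hx
  have hD := h D hy
  have h1 := norm_add_le (A x) (B y)
  have h2 := norm_add_le (C x) (D y)
  have := norm_nonneg (A x)
  have := norm_nonneg (B y)
  have := norm_nonneg (C x)
  have := norm_nonneg (D y)
  rw [blockOp_apply, Prod.norm_mk]
  apply max_le <;> linarith

theorem LaurentSummable.blockOp {a b c d : ℤ → X →L[ℂ] X} (ha : LaurentSummable a)
    (hb : LaurentSummable b) (hc : LaurentSummable c) (hd : LaurentSummable d) :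
    LaurentSummable fun n => blockOp (a n) (b n) (c n) (d n) := by
  obtain ⟨ε₁, h₁, H₁⟩ := ha
  obtain ⟨ε₂, h₂, H₂⟩ := hb
  obtain ⟨ε₃, h₃, H₃⟩ := hc
  obtain ⟨ε₄, h₄, H₄⟩ := hd
  refine ⟨min (min ε₁ ε₂) (min ε₃ ε₄), lt_min (lt_min h₁ h₂) (lt_min h₃ h₄), fun ρ h0 h => ?_⟩
  simp only [lt_min_iff] at h
  refine ((((H₁ ρ h0 h.1.1).add (H₂ ρ h0 h.1.2)).add (H₃ ρ h0 h.2.1)).add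
    (H₄ ρ h0 h.2.2)).of_nonneg_of_le (fun n => by positivity) fun n => ?_
  rw [← add_mul, ← add_mul, ← add_mul]
  exact mul_le_mul_of_nonneg_right (norm_blockOp_le _ _ _ _) (by positivity)

theorem isResolventSeq_blockOp [CompleteSpace X] {E F : X →L[ℂ] X}
    (hE : IsGDrazinInvertible E) (hF : IsGDrazinInvertible F)
    (hEFF : E * F ^ 2 = 0) (hEFE : E * F * E = 0) :
    IsResolventSeq (blockOp E 1 F 0) fun n =>
      blockOp (pencilCoeff E F (n - 1)) (pencilCoeff E F n) (F * pencilCoeff E F n)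
        (F * pencilCoeff E F (n + 1) + if n = -1 then 1 else 0) where
  left n := by
    have h1 := pencilCoeff_left hE hF hEFF hEFE n
    have h2 := pencilCoeff_left hE hF hEFF hEFE (n + 1)
    simp only [show n + 1 - 2 = n - 1 by ring, show n + 1 - 1 = n by ring] at h2
    rw [blockOp_mul, blockOp_sub]
    simp only [show n - 1 - 1 = n - 2 by ring, sub_add_cancel, one_mul, zero_mul, add_zero,
      sub_self, ← add_assoc, ← sub_sub]
    rw [h1, h2, add_sub_right_comm, sub_self, zero_add]
    have e1 : n - 1 = -1 ↔ n = 0 := by omega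
    have e2 : n + 1 = 0 ↔ n = -1 := by omega
    simp only [e1, e2, sub_self]
    split_ifs
    · exact blockOp_one
    · exact blockOp_zero
  right n := by
    have h1 := pencilCoeff_right hE hF hEFF hEFE n
    have h2 := pencilCoeff_right hE hF hEFF hEFE (n + 1)
    simp only [show n + 1 - 2 = n - 1 by ring, show n + 1 - 1 = n by ring] at h2
    have e1 : n - 1 = -1 ↔ n = 0 := by omega
    have e2 : n + 1 = 0 ↔ n = -1 := by omega
    simp only [e2] at h2
    -- The lower left entry is `F` times the right-hand recurrence at `n + 1`; the unit it produces
    -- cancels the extra term of the lower right entry.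
    have h3 : F * pencilCoeff E F (n - 1) - (F * pencilCoeff E F n * E +
        (F * pencilCoeff E F (n + 1) + if n = -1 then 1 else 0) * F) = 0 := by
      calc _ = F * (pencilCoeff E F (n - 1) - pencilCoeff E F n * E -
            pencilCoeff E F (n + 1) * F) - (if n = -1 then 1 else 0) * F := by
            rw [add_mul]
            simp only [mul_sub, mul_assoc]
            abel
        _ = 0 := by
          rw [h2]
          split_ifs <;> simp
    rw [blockOp_mul, blockOp_sub, h3]
    simp only [show n - 1 - 1 = n - 2 by ring, sub_add_cancel, mul_one, mul_zero, add_zero,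
      sub_self, ← sub_sub, e1, h1, add_sub_cancel_left]
    split_ifs
    · exact blockOp_one
    · exact blockOp_zero
  summable := by
    have h := summable_pencilCoeff hE hF
    exact (h.shift (-1)).blockOp h (h.mul_left F)
      (((h.shift 1).mul_left F).add (LaurentSummable.single (-1) 1))

end Block

/-! ### Expansion of the coefficients into one-sided series -/

/-- The window `-1, …, m` is split off so that both tails are indexed from `k = 1`, as in the stated
series. -/
theorem Summable.tsum_int_eq_sum_add_tsum_pnat {G : Type*} [NormedAddCommGroup G]
    [CompleteSpace G] {h : ℤ → G} (hs : Summable h) (m : ℕ) :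
    ∑' i, h i = ∑ i ∈ Finset.range (m + 2), h ((i : ℤ) - 1) + ∑' k : ℕ+, h (-1 - (k : ℕ)) +
      ∑' k : ℕ+, h ((k : ℕ) + m) := by
  have hs' : Summable fun i : ℤ => h (i - 1) :=
    hs.comp_injective (i := fun i : ℤ => i - 1) fun _ _ h => by simpa using h
  have h1 : Summable fun n : ℕ => h ((n : ℤ) - 1) :=
    hs'.comp_injective (i := fun n : ℕ => (n : ℤ)) Nat.cast_injective
  have h2 : Summable fun n : ℕ => h (-((n : ℤ) + 1) - 1) :=
    hs'.comp_injective (i := fun n : ℕ => -((n : ℤ) + 1)) fun _ _ h => by simpa using h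
  have e1 : ∑' i, h i = ∑' i : ℤ, h (i - 1) := ((Equiv.subRight (1 : ℤ)).tsum_eq h).symm
  have e2 : ∑' k : ℕ+, h (-1 - (k : ℕ)) = ∑' n : ℕ, h (-((n : ℤ) + 1) - 1) := by
    rw [tsum_pnat_eq_tsum_succ (f := fun k : ℕ => h (-1 - k))]
    refine tsum_congr fun k => congrArg h ?_
    push_cast
    ring
  have e3 : ∑' k : ℕ+, h ((k : ℕ) + m) = ∑' n : ℕ, h (((n + (m + 2) : ℕ) : ℤ) - 1) := by
    rw [tsum_pnat_eq_tsum_succ (f := fun k : ℕ => h (k + m))]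
    refine tsum_congr fun k => congrArg h ?_
    push_cast
    ring
  have e4 : ∑' i : ℤ, h (i - 1) = ∑' n : ℕ, h ((n : ℤ) - 1) + ∑' n : ℕ, h (-((n : ℤ) + 1) - 1) :=
    tsum_of_nat_of_neg_add_one (f := fun i : ℤ => h (i - 1)) h1 h2
  have e5 := h1.sum_add_tsum_nat_add (m + 2)
  rw [e1, e2, e3, e4, ← e5, add_right_comm]

section Expansion

variable {A : Type*} [NormedRing A] {E F : A}

theorem resolventCoeff_mul_nilpotent_term (E F : A) {n i : ℤ} (k p : ℕ) (hi : i = -k - 1)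
    (hp : n - 2 * i + 1 = p) (hp0 : p ≠ 0) :
    resolventCoeff F i * resolventCoeff E (n - 2 * i) = -(F ^ k * Fᵖ * Eᵈ ^ p) := by
  rw [resolventCoeff_of_neg F k hi, resolventCoeff_of_nonneg E p hp hp0, mul_neg]

theorem resolventCoeff_mul_inverse_term (E F : A) {n i : ℤ} (k q : ℕ) (hi : i + 1 = k)
    (hk : k ≠ 0) (hq : n - 2 * i = -q - 1) :
    resolventCoeff F i * resolventCoeff E (n - 2 * i) = -(Fᵈ ^ k * E ^ q * Eᵖ) := by
  rw [resolventCoeff_of_nonneg F k hi hk, resolventCoeff_of_neg E q hq, neg_mul, mul_assoc]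

theorem resolventCoeff_mul_mixed_term (E F : A) {n i : ℤ} (k p : ℕ) (hi : i + 1 = k)
    (hk : k ≠ 0) (hp : n - 2 * i + 1 = p) (hp0 : p ≠ 0) :
    resolventCoeff F i * resolventCoeff E (n - 2 * i) = Fᵈ ^ k * Eᵈ ^ p := by
  rw [resolventCoeff_of_nonneg F k hi hk, resolventCoeff_of_nonneg E p hp hp0, neg_mul_neg]

theorem mul_pow_inv (hF : IsGDrazinInvertible F) {k : ℕ} (hk : k ≠ 0) :
    F * Fᵈ ^ (k + 1) = Fᵈ ^ k := by
  obtain ⟨j, rfl⟩ := Nat.exists_eq_succ_of_ne_zero hk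
  rw [show j.succ + 1 = 2 + j by omega, pow_add, ← mul_assoc, hF.mul_inv_sq, Nat.succ_eq_add_one,
    pow_succ']

theorem neg_pencilCoeff_neg_one (E F : A) :
    -pencilCoeff E F (-1) = -convCoeff E F (-2) + -convCoeff E F 0 * F := by
  rw [pencilCoeff, sqCoeff_of_not_even F (by decide)]
  norm_num
  abel

theorem neg_pencilCoeff_zero (E F : A) :
    -pencilCoeff E F 0 = -convCoeff E F (-1) + -convCoeff E F 1 * F - Fᵈ ^ 2 * F := by
  have : sqCoeff F 2 = -Fᵈ ^ 2 := sqCoeff_two_mul F 1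
  simp only [pencilCoeff, zero_add, zero_sub, this]
  noncomm_ring

theorem neg_pencilCoeff_one (E F : A) :
    -pencilCoeff E F 1 = -convCoeff E F 0 + -convCoeff E F 2 * F := by
  rw [pencilCoeff, sqCoeff_of_not_even F (by decide)]
  norm_num
  abel

variable [CompleteSpace A]

/-- Up to sign this is a subfamily of the summable family defining one coefficient of `S R`; the
index `p - 3 - 2 * b` is the one that produces the required exponents. -/
theorem summable_nilpotent_terms (hE : IsGDrazinInvertible E) (hF : IsGDrazinInvertible F)
    (b p : ℕ) : Summable fun k : ℕ+ => F ^ ((k : ℕ) + b) * Fᵖ * Eᵈ ^ (2 * (k : ℕ) + p) := by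
  have hinj : Function.Injective fun k : ℕ+ => -(((k : ℕ) + b : ℕ) : ℤ) - 1 := fun k l h => by
    simpa using h
  refine (((summable_conv hE hF (p - 3 - 2 * b)).comp_injective hinj).neg).congr fun k => ?_
  have := k.pos
  simp only [Function.comp_apply]
  rw [resolventCoeff_mul_nilpotent_term E F (k + b) (2 * k + p) rfl
    (by push_cast; ring) (by omega), neg_neg]

theorem summable_nilpotent_terms_zero (hE : IsGDrazinInvertible E)
    (hF : IsGDrazinInvertible F) (p : ℕ) :
    Summable fun k : ℕ+ => F ^ (k : ℕ) * Fᵖ * Eᵈ ^ (2 * (k : ℕ) + p) :=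
  summable_nilpotent_terms hE hF 0 p

/-- The exponent is a function `q` constrained only at `k ≥ 1`, so that the truncated subtraction `2
* k - 1` is covered. -/
theorem summable_inverse_terms (hE : IsGDrazinInvertible E) (hF : IsGDrazinInvertible F)
    (a : ℕ) (q : ℕ → ℕ) (s : ℤ) (hq : ∀ k : ℕ+, (q k : ℤ) = 2 * (k : ℕ) + s) :
    Summable fun k : ℕ+ => Fᵈ ^ ((k : ℕ) + a) * E ^ q k * Eᵖ := by
  have hinj : Function.Injective fun k : ℕ+ => (((k : ℕ) + a : ℕ) : ℤ) - 1 := fun k l h => by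
    simpa using h
  refine (((summable_conv hE hF (2 * a - 3 - s)).comp_injective hinj).neg).congr fun k => ?_
  have := k.pos
  simp only [Function.comp_apply]
  rw [resolventCoeff_mul_inverse_term E F (k + a) (q k) (by ring) (by omega)
    (by rw [hq]; push_cast; ring), neg_neg]

/-- The hypothesis `hp` forces `n ≥ -3`, so for `i ≤ -2` the index `n - 2 * i` is nonnegative and
the lower tail pairs `Fᵖ` only with powers of `Eᵈ`. The cut-off `m` fixes where the series in `Fᵈ`
starts. -/
theorem neg_convCoeff (hE : IsGDrazinInvertible E) (hF : IsGDrazinInvertible F)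
    (n : ℤ) (m p : ℕ) (q : ℕ → ℕ) (hp : n + 3 = p)
    (hq : ∀ k : ℕ+, (q k : ℤ) = 2 * (k : ℕ) + 2 * m - n - 1) :
    -convCoeff E F n = -∑ i ∈ Finset.range (m + 2),
        resolventCoeff F (i - 1) * resolventCoeff E (n - 2 * (i - 1)) +
      ∑' k : ℕ+, F ^ (k : ℕ) * Fᵖ * Eᵈ ^ (2 * (k : ℕ) + p) +
      ∑' k : ℕ+, Fᵈ ^ ((k : ℕ) + (m + 1)) * E ^ q k * Eᵖ := by
  rw [convCoeff, (summable_conv hE hF n).tsum_int_eq_sum_add_tsum_pnat m, neg_add, neg_add,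
    ← tsum_neg, ← tsum_neg]
  congr 1
  · congr 1
    refine tsum_congr fun k => ?_
    have := k.pos
    rw [resolventCoeff_mul_nilpotent_term E F k (2 * k + p) (by ring)
      (by push_cast; rw [← hp]; ring) (by omega), neg_neg]
  · refine tsum_congr fun k => ?_
    rw [resolventCoeff_mul_inverse_term E F (k + (m + 1)) (q k) (by push_cast; ring) (by omega)
      (by rw [hq]; ring), neg_neg]

/-! ### The five coefficients of `S R` that enter the answer -/

theorem neg_convCoeff_neg_two (hE : IsGDrazinInvertible E) (hF : IsGDrazinInvertible F) :
    -convCoeff E F (-2) = Fᵖ * Eᵈ + Fᵈ * E * Eᵖ +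
      ∑' k : ℕ+, F ^ (k : ℕ) * Fᵖ * Eᵈ ^ (2 * (k : ℕ) + 1) +
      ∑' k : ℕ+, Fᵈ ^ ((k : ℕ) + 1) * E ^ (2 * (k : ℕ) + 1) * Eᵖ := by
  rw [neg_convCoeff hE hF (-2) 0 1 (fun k => 2 * k + 1) (by norm_num)
    (fun k => by push_cast; ring)]
  congr 2
  simp only [Finset.sum_range_succ, Finset.sum_range_zero]
  rw [resolventCoeff_mul_nilpotent_term E F 0 1 (by norm_num) (by norm_num) (by norm_num),
    resolventCoeff_mul_inverse_term E F 1 1 (by norm_num) (by norm_num) (by norm_num)]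
  noncomm_ring

theorem neg_convCoeff_neg_one (hE : IsGDrazinInvertible E) (hF : IsGDrazinInvertible F) :
    -convCoeff E F (-1) = Fᵖ * Eᵈ ^ 2 + Fᵈ * Eᵖ +
      ∑' k : ℕ+, F ^ (k : ℕ) * Fᵖ * Eᵈ ^ (2 * (k : ℕ) + 2) +
      ∑' k : ℕ+, Fᵈ ^ ((k : ℕ) + 1) * E ^ (2 * (k : ℕ)) * Eᵖ := by
  rw [neg_convCoeff hE hF (-1) 0 2 (fun k => 2 * k) (by norm_num)
    (fun k => by push_cast; ring)]
  congr 2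
  simp only [Finset.sum_range_succ, Finset.sum_range_zero]
  rw [resolventCoeff_mul_nilpotent_term E F 0 2 (by norm_num) (by norm_num) (by norm_num),
    resolventCoeff_mul_inverse_term E F 1 0 (by norm_num) (by norm_num) (by norm_num)]
  noncomm_ring

theorem neg_convCoeff_zero (hE : IsGDrazinInvertible E) (hF : IsGDrazinInvertible F) :
    -convCoeff E F 0 = Fᵖ * Eᵈ ^ 3 - Fᵈ * Eᵈ +
      ∑' k : ℕ+, F ^ (k : ℕ) * Fᵖ * Eᵈ ^ (2 * (k : ℕ) + 3) +
      ∑' k : ℕ+, Fᵈ ^ ((k : ℕ) + 1) * E ^ (2 * (k : ℕ) - 1) * Eᵖ := by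
  rw [neg_convCoeff hE hF 0 0 3 (fun k => 2 * k - 1) (by norm_num)
    (fun k => by have := k.pos; push_cast; omega)]
  congr 2
  simp only [Finset.sum_range_succ, Finset.sum_range_zero]
  rw [resolventCoeff_mul_nilpotent_term E F 0 3 (by norm_num) (by norm_num) (by norm_num),
    resolventCoeff_mul_mixed_term E F 1 1 (by norm_num) (by norm_num) (by norm_num)
      (by norm_num)]
  noncomm_ring

/-- The same coefficient cut at `m = 2` instead of `m = 0`: `Γ` starts this series two terms later
than `Ξ` does. -/
theorem neg_convCoeff_zero' (hE : IsGDrazinInvertible E) (hF : IsGDrazinInvertible F) :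
    -convCoeff E F 0 = Fᵖ * Eᵈ ^ 3 - Fᵈ * Eᵈ + Fᵈ ^ 2 * E * Eᵖ + Fᵈ ^ 3 * E ^ 3 * Eᵖ +
      ∑' k : ℕ+, F ^ (k : ℕ) * Fᵖ * Eᵈ ^ (2 * (k : ℕ) + 3) +
      ∑' k : ℕ+, Fᵈ ^ ((k : ℕ) + 3) * E ^ (2 * (k : ℕ) + 3) * Eᵖ := by
  rw [neg_convCoeff hE hF 0 2 3 (fun k => 2 * k + 3) (by norm_num)
    (fun k => by push_cast; ring)]
  congr 2
  simp only [Finset.sum_range_succ, Finset.sum_range_zero]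
  rw [resolventCoeff_mul_nilpotent_term E F 0 3 (by norm_num) (by norm_num) (by norm_num),
    resolventCoeff_mul_mixed_term E F 1 1 (by norm_num) (by norm_num) (by norm_num)
      (by norm_num),
    resolventCoeff_mul_inverse_term E F 2 1 (by norm_num) (by norm_num) (by norm_num),
    resolventCoeff_mul_inverse_term E F 3 3 (by norm_num) (by norm_num) (by norm_num)]
  noncomm_ring

theorem neg_convCoeff_one (hE : IsGDrazinInvertible E) (hF : IsGDrazinInvertible F) :
    -convCoeff E F 1 = Fᵖ * Eᵈ ^ 4 - Fᵈ * Eᵈ ^ 2 + Fᵈ ^ 2 * Eᵖ + Fᵈ ^ 3 * E ^ 2 * Eᵖ +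
      ∑' k : ℕ+, F ^ (k : ℕ) * Fᵖ * Eᵈ ^ (2 * (k : ℕ) + 4) +
      ∑' k : ℕ+, Fᵈ ^ ((k : ℕ) + 3) * E ^ (2 * (k : ℕ) + 2) * Eᵖ := by
  rw [neg_convCoeff hE hF 1 2 4 (fun k => 2 * k + 2) (by norm_num)
    (fun k => by push_cast; ring)]
  congr 2
  simp only [Finset.sum_range_succ, Finset.sum_range_zero]
  rw [resolventCoeff_mul_nilpotent_term E F 0 4 (by norm_num) (by norm_num) (by norm_num),
    resolventCoeff_mul_mixed_term E F 1 2 (by norm_num) (by norm_num) (by norm_num)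
      (by norm_num),
    resolventCoeff_mul_inverse_term E F 2 0 (by norm_num) (by norm_num) (by norm_num),
    resolventCoeff_mul_inverse_term E F 3 2 (by norm_num) (by norm_num) (by norm_num)]
  noncomm_ring

theorem neg_convCoeff_two (hE : IsGDrazinInvertible E) (hF : IsGDrazinInvertible F) :
    -convCoeff E F 2 = Fᵖ * Eᵈ ^ 5 - Fᵈ * Eᵈ ^ 3 - Fᵈ ^ 2 * Eᵈ + Fᵈ ^ 3 * E * Eᵖ +
      ∑' k : ℕ+, F ^ (k : ℕ) * Fᵖ * Eᵈ ^ (2 * (k : ℕ) + 5) +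
      ∑' k : ℕ+, Fᵈ ^ ((k : ℕ) + 3) * E ^ (2 * (k : ℕ) + 1) * Eᵖ := by
  rw [neg_convCoeff hE hF 2 2 5 (fun k => 2 * k + 1) (by norm_num)
    (fun k => by push_cast; ring)]
  congr 2
  simp only [Finset.sum_range_succ, Finset.sum_range_zero]
  rw [resolventCoeff_mul_nilpotent_term E F 0 5 (by norm_num) (by norm_num) (by norm_num),
    resolventCoeff_mul_mixed_term E F 1 3 (by norm_num) (by norm_num) (by norm_num)
      (by norm_num),
    resolventCoeff_mul_mixed_term E F 2 1 (by norm_num) (by norm_num) (by norm_num)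
      (by norm_num),
    resolventCoeff_mul_inverse_term E F 3 1 (by norm_num) (by norm_num) (by norm_num)]
  noncomm_ring

theorem mul_tsum_nilpotent (hE : IsGDrazinInvertible E) (hF : IsGDrazinInvertible F) (p : ℕ) :
    F * ∑' k : ℕ+, F ^ (k : ℕ) * Fᵖ * Eᵈ ^ (2 * (k : ℕ) + p) =
      ∑' k : ℕ+, F ^ ((k : ℕ) + 1) * Fᵖ * Eᵈ ^ (2 * (k : ℕ) + p) := by
  rw [← (summable_nilpotent_terms_zero hE hF p).tsum_mul_left]
  exact tsum_congr fun k => by simp only [pow_succ', mul_assoc]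

theorem mul_tsum_inverse (hE : IsGDrazinInvertible E) (hF : IsGDrazinInvertible F)
    (a : ℕ) (q : ℕ → ℕ) (s : ℤ) (hq : ∀ k : ℕ+, (q k : ℤ) = 2 * (k : ℕ) + s) :
    F * ∑' k : ℕ+, Fᵈ ^ ((k : ℕ) + (a + 1)) * E ^ q k * Eᵖ =
      ∑' k : ℕ+, Fᵈ ^ ((k : ℕ) + a) * E ^ q k * Eᵖ := by
  rw [← (summable_inverse_terms hE hF (a + 1) q s hq).tsum_mul_left]
  refine tsum_congr fun k => ?_
  have := k.pos
  rw [← mul_assoc, ← mul_assoc, ← add_assoc, mul_pow_inv hF (by omega)]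

theorem blockSeriesSummable (hE : IsGDrazinInvertible E) (hF : IsGDrazinInvertible F) :
    BlockSeriesSummable E F where
  gamma₁ := summable_nilpotent_terms hE hF 0 1
  gamma₂ := summable_inverse_terms hE hF 1 (fun k => 2 * k + 1) 1 fun k => by push_cast; ring
  gamma₃ := (summable_nilpotent_terms hE hF 0 3).mul_right F
  gamma₄ := (summable_inverse_terms hE hF 3 (fun k => 2 * k + 3) 3
    fun k => by push_cast; ring).mul_right F
  delta₁ := summable_nilpotent_terms hE hF 0 2
  delta₂ := summable_inverse_terms hE hF 1 (fun k => 2 * k) 0 fun k => by push_cast; ring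
  delta₃ := (summable_nilpotent_terms hE hF 0 4).mul_right F
  delta₄ := (summable_inverse_terms hE hF 3 (fun k => 2 * k + 2) 2
    fun k => by push_cast; ring).mul_right F
  lambda₁ := summable_nilpotent_terms hE hF 1 2
  lambda₂ := summable_inverse_terms hE hF 0 (fun k => 2 * k) 0 fun k => by push_cast; ring
  lambda₃ := (summable_nilpotent_terms hE hF 1 4).mul_right F
  lambda₄ := (summable_inverse_terms hE hF 2 (fun k => 2 * k + 2) 2
    fun k => by push_cast; ring).mul_right F
  xi₁ := summable_nilpotent_terms hE hF 1 3
  xi₂ := summable_inverse_terms hE hF 0 (fun k => 2 * k - 1) (-1) fun k => by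
    have := k.pos
    omega
  xi₃ := (summable_nilpotent_terms hE hF 1 5).mul_right F
  xi₄ := (summable_inverse_terms hE hF 2 (fun k => 2 * k + 1) 1
    fun k => by push_cast; ring).mul_right F

/-! ### Identification of the four entries -/

theorem blockGamma_eq (hE : IsGDrazinInvertible E) (hF : IsGDrazinInvertible F) :
    blockGamma E F = -pencilCoeff E F (-1) := by
  rw [neg_pencilCoeff_neg_one, neg_convCoeff_neg_two hE hF, neg_convCoeff_zero' hE hF, blockGamma,
    (summable_nilpotent_terms_zero hE hF 3).tsum_mul_right,
    (summable_inverse_terms hE hF 3 (fun k => 2 * k + 3) 3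
      fun k => by push_cast; ring).tsum_mul_right]
  have h : Fᵈ ^ 2 * E * Eᵖ = Fᵈ ^ 2 * E - Fᵈ ^ 2 * E ^ 2 * Eᵈ := by
    rw [spectralIdem]
    noncomm_ring
  have h1 (x : A) : Fᵖ * x = x - F * Fᵈ * x := by rw [spectralIdem, sub_mul, one_mul]
  rw [h, h1, h1]
  simp only [add_mul, sub_mul]
  abel

theorem blockDelta_eq (hE : IsGDrazinInvertible E) (hF : IsGDrazinInvertible F) :
    blockDelta E F = -pencilCoeff E F 0 := by
  rw [neg_pencilCoeff_zero, neg_convCoeff_neg_one hE hF, neg_convCoeff_one hE hF, blockDelta,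
    (summable_nilpotent_terms_zero hE hF 4).tsum_mul_right,
    (summable_inverse_terms hE hF 3 (fun k => 2 * k + 2) 2
      fun k => by push_cast; ring).tsum_mul_right]
  -- Expanding `Eᵖ` exposes the term `Fᵈ ^ 2 * F` that cancels the contribution of `S F`.
  have h : Fᵈ ^ 2 * Eᵖ = Fᵈ ^ 2 - Fᵈ ^ 2 * E * Eᵈ := by
    rw [spectralIdem]
    noncomm_ring
  have h1 (x : A) : Fᵖ * x = x - F * Fᵈ * x := by rw [spectralIdem, sub_mul, one_mul]
  rw [h, h1, h1]
  simp only [add_mul, sub_mul]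
  abel

/-- Left multiplication by `F` raises the powers of `F` by one and, by `F * Fᵈ ^ (k + 1) = Fᵈ ^ k`
for `k ≥ 1`, lowers those of `Fᵈ`. -/
theorem blockLambda_eq (hE : IsGDrazinInvertible E) (hF : IsGDrazinInvertible F) :
    blockLambda E F = F * -pencilCoeff E F 0 := by
  have h1 := mul_pow_inv hF one_ne_zero
  have h2 := mul_pow_inv hF two_ne_zero
  norm_num at h1 h2
  have h3 := mul_tsum_inverse hE hF 0 (fun k => 2 * k) 0 fun k => by push_cast; ring
  have h4 := mul_tsum_inverse hE hF 2 (fun k => 2 * k + 2) 2 fun k => by push_cast; ring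
  norm_num at h3 h4
  have h : Fᵈ * Eᵖ = Fᵈ - Fᵈ * E * Eᵈ := by
    rw [spectralIdem]
    noncomm_ring
  rw [neg_pencilCoeff_zero, neg_convCoeff_neg_one hE hF, neg_convCoeff_one hE hF, blockLambda,
    (summable_nilpotent_terms hE hF 1 4).tsum_mul_right,
    (summable_inverse_terms hE hF 2 (fun k => 2 * k + 2) 2
      fun k => by push_cast; ring).tsum_mul_right]
  simp only [mul_add, mul_sub, ← mul_assoc, mul_tsum_nilpotent hE hF, h1, h2, h3, h4, add_mul,
    sub_mul]
  rw [h]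
  simp only [sub_mul]
  abel

theorem blockXi_eq (hE : IsGDrazinInvertible E) (hF : IsGDrazinInvertible F) :
    blockXi E F = F * -pencilCoeff E F 1 := by
  have h1 := mul_pow_inv hF one_ne_zero
  have h2 := mul_pow_inv hF two_ne_zero
  norm_num at h1 h2
  have h3 := mul_tsum_inverse hE hF 0 (fun k => 2 * k - 1) (-1) fun k => by
    have := k.pos
    omega
  have h4 := mul_tsum_inverse hE hF 2 (fun k => 2 * k + 1) 1 fun k => by push_cast; ring
  norm_num at h3 h4
  have h : Fᵈ ^ 2 * E * Eᵖ = Fᵈ ^ 2 * E - Fᵈ ^ 2 * E ^ 2 * Eᵈ := by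
    rw [spectralIdem]
    noncomm_ring
  rw [neg_pencilCoeff_one, neg_convCoeff_zero hE hF, neg_convCoeff_two hE hF, blockXi,
    (summable_nilpotent_terms hE hF 1 5).tsum_mul_right,
    (summable_inverse_terms hE hF 2 (fun k => 2 * k + 1) 1
      fun k => by push_cast; ring).tsum_mul_right]
  simp only [mul_add, mul_sub, ← mul_assoc, mul_tsum_nilpotent hE hF, h1, h2, h3, h4, add_mul,
    sub_mul]
  rw [h]
  simp only [sub_mul]
  abel

end Expansion

theorem theorem2p3 {X : Type*} [NormedAddCommGroup X] [NormedSpace ℂ X] [CompleteSpace X]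
    (E F : X →L[ℂ] X) (hE : IsGDrazinInvertible E) (hF : IsGDrazinInvertible F)
    (hEFF : E * F ^ 2 = 0) (hEFE : E * F * E = 0) :
    IsGDrazinInvertible (blockOp E 1 F 0) ∧
      BlockSeriesSummable E F ∧
      (blockOp E 1 F 0)ᵈ =
        blockOp (blockGamma E F) (blockDelta E F) (blockLambda E F) (blockXi E F) := by
  have h := (isResolventSeq_blockOp hE hF hEFF hEFE).isGDrazinInverse
  have hM : IsGDrazinInvertible (blockOp E 1 F 0) := ⟨_, h⟩
  refine ⟨hM, blockSeriesSummable hE hF, ?_⟩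
  rw [hM.spec.unique h, blockOp_neg, blockGamma_eq hE hF, blockDelta_eq hE hF,
    blockLambda_eq hE hF, blockXi_eq hE hF]
  -- At `n = 0` the summand `if n = -1 then 1 else 0` of the lower right entry vanishes.
  simp
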